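/- **Setting.** Let $H>0$ be real and let $\ell,K,V,T\ge 1$ be integers. A length-$\ell$ menu of two-part tariffs is a vector $\rho=((p_1^{(j)},p_2^{(j)}))_{j=1}^{\ell}\in[0,H]^{2\ell}$. An option is a pair $(j,k)$ of a tariff index $j\in\{1,\dots,\ell\}$ and a number of units $k\in\{0,\dots,K\}$; its payment is $p_1^{(j)}+k\,p_2^{(j)}$ if $k\ge 1$, and $0$ if $k=0$. A buyer type is a valuation $v:\{0,\dots,K\}\to[0,H]$ that is nondecreasing with $v(0)=0$; given a menu, the buyer selects an option that maximizes $v(k)$ minus the payment, with ties broken by an arbitrary fixed rule. Let $u(v,\rho)$ be the payment for the selected option. There are $V$ buyer types $v_1,\dots,v_V$; the types and their selection rules, $H$, $\ell$, $K$ and $T$ are known to the seller. In each round $t=1,\dots,T$ a buyer of an unknown type $b_t\in\{v_1,\dots,v_V\}$ arrives, a randomized algorithm presents a menu $\rho_t$ depending on the history, and it observes only the option selected by the buyer (bandit feedback). The sequence $b$ is arbitrary and fixed in advance. The expected regret is $$R_T(b)=\mathbb E\Big[\sup_{\rho\in[0,H]^{2\ell}}\sum_{t=1}^T u(b_t,\rho)-\sum_{t=1}^T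 u(b_t,\rho_t)\Big].$$ **Theorem.** There are universal constants $C>0$ and $c\in\mathbb N$ such that, for all $H,\ell,K,V,T$, all $V$ buyer types and all tie-breaking rules as above, there is an algorithm such that the following holds for every sequence $b$ of buyer types. Put $$B=C\,(1+\log T)^c\;T^{2/3}\,\ell\,(HKV)^{1/3}\,\log^{1/3}(1+V\ell K).$$ If $H\le 1$ or $T\ge H^4V$, then $R_T(b)\le B$, that is, $R_T(b)=\tilde O\big(T^{2/3}\ell(HKV)^{1/3}\log^{1/3}(V\ell K)\big)$. For all $H$ and $T$, $R_T(b)\le \max(1,H)^{2/3}\,B$. -/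

import Mathlib

noncomputable section

namespace TwoPartTariff

/-- A length-`ℓ` menu of two-part tariffs with prices in `[0, H]`: tariff `j` has the up-front fee
`(ρ j).1` and the per-unit fee `(ρ j).2`.  This is the parameter space `[0, H] ^ (2 ℓ)`. -/
abbrev Menu (H : ℝ) (ℓ : ℕ) : Type :=
  Fin ℓ → Set.Icc (0 : ℝ) H × Set.Icc (0 : ℝ) H

/-- A menu option `(j, k)`: a tariff index and a number of units `0 ≤ k ≤ K`.
Options with `k = 0` all mean that nothing is bought (and nothing is paid). -/
abbrev Choice (ℓ K : ℕ) : Type := Fin ℓ × Fin (K + 1)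

/-- Buyer valuations for `0, 1, …, K` units: nonnegative, bounded by `H`, increasing in the number
of units, with value `0` for zero units. -/
structure IsValuation (H : ℝ) {K : ℕ} (v : Fin (K + 1) → ℝ) : Prop where
  zero : v 0 = 0
  mono : Monotone v
  mem_Icc : ∀ k, v k ∈ Set.Icc (0 : ℝ) H

variable {H : ℝ} {ℓ K V : ℕ}

/-- The payment for option `(j, k)`: `p₁ + k p₂` if `k ≥ 1`, and `0` if nothing is bought. -/
def payment (ρ : Menu H ℓ) (o : Choice ℓ K) : ℝ :=
  if 1 ≤ (o.2 : ℕ) then ((ρ o.1).1 : ℝ) + ((o.2 : ℕ) : ℝ) * ((ρ o.1).2 : ℝ) else 0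

/-- The buyer's utility: the value of the units received less the payment. -/
def utility (v : Fin (K + 1) → ℝ) (ρ : Menu H ℓ) (o : Choice ℓ K) : ℝ :=
  v o.2 - payment ρ o

/-- `σ` describes the behaviour of a buyer with valuation `v`: from every menu `ρ` she selects an
option `σ ρ` that maximizes her utility.  Ties may be broken in any way. -/
def IsBuyerChoice (v : Fin (K + 1) → ℝ) (σ : Menu H ℓ → Choice ℓ K) : Prop :=
  ∀ ρ o, utility v ρ o ≤ utility v ρ (σ ρ)

/-- What the seller has seen so far, oldest round first: the menus presented and, for each of them,
the option selected by the buyer of that round. -/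
abbrev History (H : ℝ) (ℓ K : ℕ) : Type := List (Menu H ℓ × Choice ℓ K)

/-- A randomized online algorithm under bandit feedback: a rule that gives the distribution of the
next menu as a function of the history. -/
abbrev BanditAlgorithm (H : ℝ) (ℓ K : ℕ) : Type := History H ℓ K → PMF (Menu H ℓ)

/-- The distribution of the history after `t` rounds when the algorithm `A` faces buyers of types
`b 0, b 1, …`, where buyers of type `i` select options according to `σ i`. -/
def historyLaw (A : BanditAlgorithm H ℓ K) (σ : Fin V → Menu H ℓ → Choice ℓ K) (b : ℕ → Fin V) :
    ℕ → PMF (History H ℓ K)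
  | 0 => PMF.pure []
  | t + 1 => (historyLaw A σ b t).bind fun h =>
      (A h).map fun ρ => h ++ [(ρ, σ (b t) ρ)]

/-- The seller's total revenue along a history. -/
def historyRevenue (h : History H ℓ K) : ℝ := (h.map fun x => payment x.1 x.2).sum

/-- The best total revenue that a single menu obtains from the first `T` buyers. -/
def bestRevenue (σ : Fin V → Menu H ℓ → Choice ℓ K) (b : ℕ → Fin V) (T : ℕ) : ℝ :=
  ⨆ ρ : Menu H ℓ, ∑ t ∈ Finset.range T, payment ρ (σ (b t) ρ)

/-- The expected regret of `A` over the first `T` rounds on the sequence `b` of buyer types; the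
expectation is over the randomness of the algorithm. -/
def expectedRegret (A : BanditAlgorithm H ℓ K) (σ : Fin V → Menu H ℓ → Choice ℓ K)
    (b : ℕ → Fin V) (T : ℕ) : ℝ :=
  ∑' h : History H ℓ K,
    (historyLaw A σ b T h).toReal * (bestRevenue σ b T - historyRevenue h)

/-- `T ^ (2/3) · ℓ · (H K V) ^ (1/3) · log ^ (1/3) (1 + V ℓ K)`. -/
def regretRate (H : ℝ) (ℓ K V T : ℕ) : ℝ :=
  (T : ℝ) ^ (2 / 3 : ℝ) * ℓ * (H * K * V) ^ (1 / 3 : ℝ) *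
    Real.log (1 + (V : ℝ) * ℓ * K) ^ (1 / 3 : ℝ)

end TwoPartTariff

end

/-!
The rewards of a menu form a vector with one entry per buyer type, so the seller plays a linear
bandit in dimension at most `V`, and regret of order `√(V T log N)` against `N` menus is attainable.
This suffices for the `T ^ (2/3)` rate: `H √(V T)` is at most `T ^ (2/3) (H V) ^ (1/3)` exactly
when `H ^ 4 V ≤ T` (`mul_sqrt_le_rpow`).  With `H = 1` this condition reads `V ≤ T`, and in the
remaining case `V > T` the trivial bound `H T` suffices.

*Estimation.*  Maximizing the determinant of the second-moment matrix gives an exploration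
distribution `π` under which every action has leverage at most the dimension
(`exists_optimal_design`, one direction of the Kiefer–Wolfowitz theorem).  Least squares under a
distribution `p ≥ γ π` then gives unbiased estimates of the rewards of all menus, bounded by `V / γ`
and with second moment at most `V` on average (`exists_estimator`).

*Exponential weights.*  Exponential weights on these estimates, mixed with `π` at rate `γ`, have
regret `H (V log N / γ + 3 γ T)` (`exists_algorithm_finite`).  The proof follows the expected growth
of the log-partition function of the scores round by round (`expected_log_sum_exp_le`).

*Discretization.*  If all prices are multiplied by `1 - 1/√T` and then rounded down to a grid of
mesh `H/T` in payments, dearer options get larger discounts, so that a buyer who changes her option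
moves to one that is cheaper by at most `O(H/√T)`, however ties are broken
(`IsBuyerChoice.payment_sub_le_of_discount`).  Hence grid menus lose only `O(H √T)` in total, and
the logarithm of their number is at most of order `ℓ (log T + log K)`.
-/

noncomputable section

/-! ### Optimal designs and least-squares estimates -/

namespace LinearBandit

open Matrix

variable {ι : Type*} [Fintype ι] {d : ℕ}

/-- The second-moment matrix `∑ i, p i • y i (y i)ᵀ` of the action vectors `y` under the weights
`p`. -/
def designMatrix (y : ι → Fin d → ℝ) (p : ι → ℝ) : Matrix (Fin d) (Fin d) ℝ :=
  ∑ i, p i • vecMulVec (y i) (y i)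

lemma designMatrix_mulVec (y : ι → Fin d → ℝ) (p : ι → ℝ) (z : Fin d → ℝ) :
    designMatrix y p *ᵥ z = ∑ i, (p i * (y i ⬝ᵥ z)) • y i := by
  rw [designMatrix, Matrix.sum_mulVec]
  refine Finset.sum_congr rfl fun i _ => ?_
  rw [Matrix.smul_mulVec, vecMulVec_mulVec, mul_smul]
  simp

lemma dotProduct_designMatrix_mulVec (y : ι → Fin d → ℝ) (p : ι → ℝ) (w z : Fin d → ℝ) :
    w ⬝ᵥ designMatrix y p *ᵥ z = ∑ i, p i * (y i ⬝ᵥ w) * (y i ⬝ᵥ z) := by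
  rw [designMatrix_mulVec, dotProduct_sum]
  refine Finset.sum_congr rfl fun i _ => ?_
  rw [dotProduct_smul, dotProduct_comm w, smul_eq_mul]
  ring

lemma isHermitian_designMatrix (y : ι → Fin d → ℝ) (p : ι → ℝ) :
    (designMatrix y p).IsHermitian := by
  rw [Matrix.IsHermitian, designMatrix, conjTranspose_sum]
  refine Finset.sum_congr rfl fun i _ => ?_
  ext a b
  simp [vecMulVec_apply, mul_comm]

lemma posSemidef_designMatrix (y : ι → Fin d → ℝ) {p : ι → ℝ} (hp : ∀ i, 0 ≤ p i) :
    (designMatrix y p).PosSemidef := by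
  refine .of_dotProduct_mulVec_nonneg (isHermitian_designMatrix y p) fun z => ?_
  rw [star_trivial, dotProduct_designMatrix_mulVec]
  exact Finset.sum_nonneg fun i _ => by
    rw [mul_assoc]; exact mul_nonneg (hp i) (mul_self_nonneg _)

lemma posDef_designMatrix {y : ι → Fin d → ℝ} (hy : ∀ z, (∀ i, y i ⬝ᵥ z = 0) → z = 0)
    {p : ι → ℝ} (hp : ∀ i, 0 < p i) : (designMatrix y p).PosDef := by
  refine .of_dotProduct_mulVec_pos (isHermitian_designMatrix y p) fun z hz => ?_
  rw [star_trivial, dotProduct_designMatrix_mulVec]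
  obtain ⟨i, hi⟩ : ∃ i, y i ⬝ᵥ z ≠ 0 := by
    by_contra! h
    exact hz (hy z h)
  refine Finset.sum_pos' (fun i _ => ?_) ⟨i, Finset.mem_univ i, ?_⟩
  · rw [mul_assoc]; exact mul_nonneg (hp i).le (mul_self_nonneg _)
  · rw [mul_assoc]; exact mul_pos (hp i) (mul_self_pos.mpr hi)

/-- The Cauchy–Schwarz inequality for the bilinear form of a positive semidefinite matrix. -/
lemma sq_dotProduct_mulVec_le {B : Matrix (Fin d) (Fin d) ℝ} (hB : B.PosSemidef)
    (u w : Fin d → ℝ) :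
    (u ⬝ᵥ B *ᵥ w) ^ 2 ≤ (u ⬝ᵥ B *ᵥ u) * (w ⬝ᵥ B *ᵥ w) := by
  have hsymm : w ⬝ᵥ B *ᵥ u = u ⬝ᵥ B *ᵥ w := by
    rw [dotProduct_mulVec, dotProduct_comm, ← mulVec_transpose]
    congr 2
    simpa using hB.isHermitian.eq
  -- The quadratic `t ↦ (u + t w)ᵀ B (u + t w)` is nonnegative, so its discriminant is not positive.
  have h : ∀ t : ℝ, 0 ≤ (w ⬝ᵥ B *ᵥ w) * (t * t) + (2 * (u ⬝ᵥ B *ᵥ w)) * t + u ⬝ᵥ B *ᵥ u := by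
    intro t
    have := hB.dotProduct_mulVec_nonneg (u + t • w)
    simp only [star_trivial, mulVec_add, mulVec_smul, add_dotProduct, dotProduct_add,
      smul_dotProduct, dotProduct_smul, smul_eq_mul, hsymm] at this
    linarith
  have := discrim_le_zero h
  rw [discrim] at this
  nlinarith

/-- The direction of the Kiefer–Wolfowitz equivalence theorem used here: there is a distribution
`π` on the actions, obtained by maximizing `det (designMatrix y π)`, under which no action has
leverage above the dimension. -/
lemma exists_optimal_design [Nonempty ι] [DecidableEq ι] {y : ι → Fin d → ℝ}
    (hy : ∀ z, (∀ i, y i ⬝ᵥ z = 0) → z = 0) :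
    ∃ π ∈ stdSimplex ℝ ι, (designMatrix y π).PosDef ∧
      ∀ i, y i ⬝ᵥ (designMatrix y π)⁻¹ *ᵥ y i ≤ d := by
  have hcont : Continuous fun p : ι → ℝ => (designMatrix y p).det := by
    unfold designMatrix
    fun_prop
  have hcard : (0 : ℝ) < Fintype.card ι := by exact_mod_cast Fintype.card_pos
  have hunif : (fun _ : ι => (Fintype.card ι : ℝ)⁻¹) ∈ stdSimplex ℝ ι :=
    ⟨fun _ => by positivity, by simp⟩
  obtain ⟨π, hπ, hmax⟩ := (isCompact_stdSimplex ℝ ι).exists_isMaxOn ⟨_, hunif⟩ hcont.continuousOn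
  have hdet : 0 < (designMatrix y π).det :=
    (posDef_designMatrix hy fun _ => by positivity).det_pos.trans_le (hmax hunif)
  set M := designMatrix y π with hM
  have hu : IsUnit M := (Matrix.isUnit_iff_isUnit_det M).2 hdet.ne'.isUnit
  have hPD : M.PosDef := (posSemidef_designMatrix y hπ.1).posDef_iff_isUnit.2 hu
  refine ⟨π, hπ, hPD, fun i => ?_⟩
  set g := y i ⬝ᵥ M⁻¹ *ᵥ y i with hg
  -- Moving mass `s` from `π` to the action `i` cannot increase the determinant.
  have key : ∀ s : ℝ, 0 < s → s < 1 → (1 - s) ^ d * (1 + s / (1 - s) * g) ≤ 1 := by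
    intro s hs0 hs1
    have hs : 0 < 1 - s := by linarith
    have hmem : (fun j => (1 - s) * π j + s * (if j = i then 1 else 0)) ∈ stdSimplex ℝ ι := by
      refine ⟨fun j => ?_, ?_⟩
      · have := hπ.1 j
        dsimp only
        split_ifs <;> positivity
      · rw [Finset.sum_add_distrib, ← Finset.mul_sum, ← Finset.mul_sum, hπ.2]
        simp
    have hle := hmax hmem
    have heq : designMatrix y (fun j => (1 - s) * π j + s * (if j = i then 1 else 0)) =
        (1 - s) • (M + replicateCol Unit ((s / (1 - s)) • y i) * replicateRow Unit (y i)) := by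
      rw [← vecMulVec_eq Unit, smul_add, hM]
      simp only [designMatrix, add_smul, Finset.sum_add_distrib, Finset.smul_sum, mul_smul]
      congr 1
      rw [← Finset.smul_sum]
      simp only [ite_smul, one_smul, zero_smul, Finset.sum_ite_eq', Finset.mem_univ, if_true]
      rw [smul_vecMulVec, smul_smul]
      congr 1
      field_simp
    simp only [Set.mem_ofPred_eq] at hle
    rw [heq, det_smul,
      det_add_replicateCol_mul_replicateRow ((Matrix.isUnit_iff_isUnit_det M).1 hu),
      Fintype.card_fin] at hle
    have hone : (1 + replicateRow Unit (y i) * M⁻¹ * replicateCol Unit ((s / (1 - s)) • y i)).det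
        = 1 + s / (1 - s) * g := by
      rw [det_unique, hg, dotProduct_mulVec, ← smul_eq_mul, ← dotProduct_smul]
      simp only [Matrix.mul_apply, dotProduct, vecMul, replicateRow_apply, replicateCol_apply,
        Matrix.add_apply, one_apply_eq, Pi.smul_apply, smul_eq_mul]
    rw [hone] at hle
    have : M.det * ((1 - s) ^ d * (1 + s / (1 - s) * g)) ≤ M.det * 1 := by linarith
    exact le_of_mul_le_mul_left this hdet
  -- Bernoulli's inequality turns this into `g ≤ d` as `s → 0`.
  have lin : ∀ s : ℝ, 0 < s → s < 1 → (1 - d * s) * (1 - s + s * g) ≤ 1 - s := by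
    intro s hs0 hs1
    have hs : 0 < 1 - s := by linarith
    have hg0 : 0 ≤ g := by
      have := hPD.inv.posSemidef.dotProduct_mulVec_nonneg (y i)
      simpa using this
    have hB := one_add_mul_le_pow (a := -s) (by linarith) d
    have h1 := key s hs0 hs1
    have h2 : (1 - s) ^ d * (1 - s + s * g) ≤ 1 - s := by
      have : (1 - s) ^ d * (1 - s + s * g) = (1 - s) * ((1 - s) ^ d * (1 + s / (1 - s) * g)) := by
        field_simp
      rw [this]
      nlinarith
    refine le_trans (mul_le_mul_of_nonneg_right ?_ (by positivity)) h2
    calc (1 : ℝ) - d * s = 1 + d * -s := by ring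
      _ ≤ (1 + -s) ^ d := hB
      _ = (1 - s) ^ d := by ring
  by_contra! hlt
  have lin' : ∀ s : ℝ, 0 < s → s < 1 → g - d ≤ s * (d * (g - 1)) := by
    intro s hs0 hs1
    have := lin s hs0 hs1
    have : s * (g - d) ≤ s * (s * (d * (g - 1))) := by nlinarith
    exact le_of_mul_le_mul_left this hs0
  have hlim : Filter.Tendsto (fun s : ℝ => s * (d * (g - 1))) (nhdsWithin 0 (Set.Ioi 0))
      (nhds 0) := by
    have : Filter.Tendsto (fun s : ℝ => s * (d * (g - 1))) (nhds 0) (nhds (0 * (d * (g - 1)))) :=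
      (continuous_id.mul continuous_const).tendsto 0
    rw [zero_mul] at this
    exact this.mono_left nhdsWithin_le_nhds
  have := ge_of_tendsto hlim (b := g - d) (by
    filter_upwards [Ioo_mem_nhdsGT (zero_lt_one' ℝ)] with s hs using lin' s hs.1 hs.2)
  linarith

/-- The least-squares estimation kernel for action vectors `y` and a design
`π` with leverages at most `d`, when actions are drawn from `p ≥ γ π`. -/
lemma exists_estimator_of_design {y : ι → Fin d → ℝ} {π : ι → ℝ}
    (hπ : ∀ i, 0 ≤ π i) (hPD : (designMatrix y π).PosDef)
    (hlev : ∀ i, y i ⬝ᵥ (designMatrix y π)⁻¹ *ᵥ y i ≤ d)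
    {γ : ℝ} (hγ : 0 < γ) {p : ι → ℝ} (hp : ∀ i, γ * π i ≤ p i) :
    ∃ k : ι → ι → ℝ,
      (∀ x θ, ∑ a, p a * (k a x * (y a ⬝ᵥ θ)) = y x ⬝ᵥ θ) ∧
      (∀ a x, |k a x| ≤ d / γ) ∧
      ∑ x, p x * ∑ a, p a * k a x ^ 2 ≤ d := by
  set M := designMatrix y π
  set P := designMatrix y p with hP
  have hp0 : ∀ i, 0 ≤ p i := fun i => (mul_nonneg hγ.le (hπ i)).trans (hp i)
  have hdom : ∀ z, γ * (z ⬝ᵥ M *ᵥ z) ≤ z ⬝ᵥ P *ᵥ z := by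
    intro z
    rw [dotProduct_designMatrix_mulVec, dotProduct_designMatrix_mulVec, Finset.mul_sum]
    refine Finset.sum_le_sum fun i _ => ?_
    nlinarith [mul_le_mul_of_nonneg_right (hp i) (mul_self_nonneg (y i ⬝ᵥ z))]
  have hPP : P.PosDef := by
    refine .of_dotProduct_mulVec_pos (isHermitian_designMatrix y p) fun z hz => ?_
    have h1 := hPD.dotProduct_mulVec_pos hz
    rw [star_trivial] at h1 ⊢
    exact (mul_pos hγ h1).trans_le (hdom z)
  have hPdet : IsUnit P.det := (Matrix.isUnit_iff_isUnit_det P).1 hPP.isUnit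
  have hMdet : IsUnit M.det := (Matrix.isUnit_iff_isUnit_det M).1 hPD.isUnit
  have hinv : ∀ z, P *ᵥ P⁻¹ *ᵥ z = z := fun z => by
    rw [mulVec_mulVec, mul_nonsing_inv _ hPdet, one_mulVec]
  have hinv' : ∀ z, P⁻¹ *ᵥ P *ᵥ z = z := fun z => by
    rw [mulVec_mulVec, nonsing_inv_mul _ hPdet, one_mulVec]
  have hinvM : ∀ z, M *ᵥ M⁻¹ *ᵥ z = z := fun z => by
    rw [mulVec_mulVec, mul_nonsing_inv _ hMdet, one_mulVec]
  have hPsymm : ∀ u w, u ⬝ᵥ P⁻¹ *ᵥ w = w ⬝ᵥ P⁻¹ *ᵥ u := by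
    intro u w
    rw [dotProduct_mulVec, dotProduct_comm, ← mulVec_transpose]
    congr 2
    simpa using hPP.inv.isHermitian.eq
  -- Leverages under `p` are at most `d / γ`.
  have hlevP : ∀ i, y i ⬝ᵥ P⁻¹ *ᵥ y i ≤ d / γ := by
    intro i
    set z := P⁻¹ *ᵥ y i with hz
    have hzP : z ⬝ᵥ P *ᵥ z = y i ⬝ᵥ z := by rw [hz, hinv, dotProduct_comm]
    have hcs := sq_dotProduct_mulVec_le hPD.posSemidef z (M⁻¹ *ᵥ y i)
    rw [hinvM, dotProduct_comm z (y i), dotProduct_comm (M⁻¹ *ᵥ y i) (y i)] at hcs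
    have hd := hdom z
    rw [hzP] at hd
    have hc0 : 0 ≤ y i ⬝ᵥ z := by
      have := hPP.posSemidef.dotProduct_mulVec_nonneg z
      rwa [star_trivial, hzP] at this
    have hM0 : 0 ≤ z ⬝ᵥ M *ᵥ z := by
      have := hPD.posSemidef.dotProduct_mulVec_nonneg z
      rwa [star_trivial] at this
    rw [le_div_iff₀ hγ]
    rcases hc0.eq_or_lt with h0 | h0
    · rw [← h0]; simp
    · have h3 : (y i ⬝ᵥ z) ^ 2 ≤ (z ⬝ᵥ M *ᵥ z) * d :=
        hcs.trans (mul_le_mul_of_nonneg_left (hlev i) hM0)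
      have h4 : (y i ⬝ᵥ z) * ((y i ⬝ᵥ z) * γ) ≤ (y i ⬝ᵥ z) * d := by
        nlinarith [mul_le_mul_of_nonneg_right hd (Nat.cast_nonneg (α := ℝ) d)]
      exact le_of_mul_le_mul_left h4 h0
  have hquad : ∀ u, ∑ a, p a * (y a ⬝ᵥ P⁻¹ *ᵥ u) ^ 2 = u ⬝ᵥ P⁻¹ *ᵥ u := by
    intro u
    have := dotProduct_designMatrix_mulVec y p (P⁻¹ *ᵥ u) (P⁻¹ *ᵥ u)
    rw [← hP, hinv, dotProduct_comm] at this
    rw [this]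
    exact Finset.sum_congr rfl fun a _ => by ring
  refine ⟨fun a x => y a ⬝ᵥ P⁻¹ *ᵥ y x, fun x θ => ?_, fun a x => ?_, ?_⟩
  · have := dotProduct_designMatrix_mulVec y p (P⁻¹ *ᵥ y x) θ
    rw [← hP, dotProduct_comm, hPsymm, hinv'] at this
    rw [this]
    exact Finset.sum_congr rfl fun a _ => by ring
  · have hcs := sq_dotProduct_mulVec_le hPP.inv.posSemidef (y a) (y x)
    have h0 : 0 ≤ y x ⬝ᵥ P⁻¹ *ᵥ y x := by
      have := hPP.inv.posSemidef.dotProduct_mulVec_nonneg (y x)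
      rwa [star_trivial] at this
    refine abs_le_of_sq_le_sq ?_ (by positivity)
    rw [pow_two (_ / _)]
    exact hcs.trans (mul_le_mul (hlevP a) (hlevP x) h0 (by positivity))
  · -- `∑ x, p x • (y x)ᵀ P⁻¹ (y x) = tr (P⁻¹ P) = d`.
    simp only [hquad]
    have : ∑ x, p x * (y x ⬝ᵥ P⁻¹ *ᵥ y x) = (P⁻¹ * P).trace := by
      rw [hP, designMatrix, Matrix.mul_sum, trace_sum]
      refine Finset.sum_congr rfl fun i _ => ?_
      rw [Matrix.mul_smul, trace_smul, mul_vecMulVec, trace_vecMulVec, smul_eq_mul, dotProduct_comm]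
    rw [this, nonsing_inv_mul _ hPdet, trace_one, Fintype.card_fin]

/-- The estimation kernel for a reward table `r` with columns `Fin V`.  There is an exploration
distribution `π` such that, when the played action `a` is drawn from any `p ≥ γ π`, the quantity
`k a x * r a j` is an unbiased estimate of `r x j` for every action `x` and every column `j`, is
controlled by `V / γ`, and has second moment at most `V` on average over `x`.  The rows of `r` need
not span `ℝ ^ V`: they are expressed in a basis of their span. -/
theorem exists_estimator [Nonempty ι] [DecidableEq ι] {V : ℕ} (r : ι → Fin V → ℝ) :
    ∃ π ∈ stdSimplex ℝ ι, ∀ γ : ℝ, 0 < γ → ∀ p : ι → ℝ, (∀ i, γ * π i ≤ p i) →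
      ∃ k : ι → ι → ℝ,
        (∀ x j, ∑ a, p a * (k a x * r a j) = r x j) ∧
        (∀ a x, |k a x| ≤ V / γ) ∧
        ∑ x, p x * ∑ a, p a * k a x ^ 2 ≤ V := by
  set W := Submodule.span ℝ (Set.range r) with hW
  let b := Module.finBasis ℝ W
  have hmem : ∀ i, r i ∈ W := fun i => Submodule.subset_span ⟨i, rfl⟩
  have hdV : (Module.finrank ℝ W : ℝ) ≤ V := by
    have := Submodule.finrank_le W
    rw [Module.finrank_fin_fun] at this
    exact_mod_cast this
  let y : ι → Fin (Module.finrank ℝ W) → ℝ := fun i => b.repr ⟨r i, hmem i⟩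
  have hr : ∀ i j, r i j = y i ⬝ᵥ fun m => (b m : Fin V → ℝ) j := by
    intro i j
    have h := congrArg (fun w : W => (w : Fin V → ℝ) j) (b.sum_repr ⟨r i, hmem i⟩)
    simp only [Submodule.coe_sum, Submodule.coe_smul, Finset.sum_apply, Pi.smul_apply,
      smul_eq_mul] at h
    exact h.symm
  have hy : ∀ z, (∀ i, y i ⬝ᵥ z = 0) → z = 0 := by
    intro z hz
    -- `φ w = repr w ⬝ᵥ z` vanishes on the generators of `W`, hence on the basis `b`.
    let φ : W →ₗ[ℝ] ℝ := b.constr ℝ z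
    have hφ : ∀ w : W, φ w = b.repr w ⬝ᵥ z := fun w => by
      simp [φ, Module.Basis.constr_apply_fintype, dotProduct]
    have h0 : ∀ w (hw : w ∈ W), φ ⟨w, hw⟩ = 0 := by
      intro w hw
      induction hw using Submodule.span_induction with
      | mem w h =>
        obtain ⟨i, rfl⟩ := h
        rw [hφ]; exact hz i
      | zero => exact map_zero φ
      | add u w hu hw ihu ihw =>
        have := map_add φ ⟨u, hu⟩ ⟨w, hw⟩
        rw [ihu, ihw, add_zero] at this
        exact this
      | smul c w hw ih =>
        have := map_smul φ c ⟨w, hw⟩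
        rw [ih, smul_zero] at this
        exact this
    funext m
    have := h0 (b m) (b m).2
    simpa [φ] using this
  obtain ⟨π, hπ, hPD, hlev⟩ := exists_optimal_design hy
  refine ⟨π, hπ, fun γ hγ p hp => ?_⟩
  obtain ⟨k, h1, h2, h3⟩ := exists_estimator_of_design hπ.1 hPD hlev hγ hp
  refine ⟨k, fun x j => ?_, fun a x => (h2 a x).trans (by gcongr), h3.trans hdV⟩
  simp only [hr]
  exact h1 x _

end LinearBandit

/-! ### Expectations and exponential weights -/

namespace LinearBandit

variable {α β : Type*}

/-- The expectation of a real function under a probability mass function.  If the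
series diverges, its value is zero; for finite supports it is a finite sum. -/
def expect (p : PMF α) (f : α → ℝ) : ℝ := ∑' x, (p x).toReal * f x

lemma expect_eq_sum {p : PMF α} {s : Finset α} (hs : p.support ⊆ s) (f : α → ℝ) :
    expect p f = ∑ x ∈ s, (p x).toReal * f x := by
  refine tsum_eq_sum fun x hx => ?_
  have : p x = 0 := by
    rw [PMF.apply_eq_zero_iff]
    exact fun h => hx (hs h)
  simp [this]

lemma expect_pure (a : α) (f : α → ℝ) : expect (PMF.pure a) f = f a := by
  rw [expect_eq_sum (s := {a}) (by simp)]
  simp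

lemma expect_bind {p : PMF α} {q : α → PMF β} (hp : p.support.Finite)
    (hq : ∀ x, (q x).support.Finite) (f : β → ℝ) :
    expect (p.bind q) f = expect p fun x => expect (q x) f := by
  classical
  set s := hp.toFinset with hs
  set u := s.biUnion fun x => (hq x).toFinset with hu
  have hps : p.support ⊆ s := by simp [hs]
  have hqu : ∀ x ∈ s, (q x).support ⊆ u := by
    intro x hx y hy
    simp only [hu, Finset.coe_biUnion, Set.mem_iUnion]
    exact ⟨x, hx, by simpa using hy⟩
  have hpu : (p.bind q).support ⊆ u := by
    rw [PMF.support_bind]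
    exact Set.iUnion₂_subset fun x hx => hqu x (hps hx)
  have hval : ∀ y, (p.bind q y).toReal = ∑ x ∈ s, (p x).toReal * (q x y).toReal := by
    intro y
    rw [PMF.bind_apply, tsum_eq_sum (s := s), ENNReal.toReal_sum]
    · exact Finset.sum_congr rfl fun x _ => ENNReal.toReal_mul
    · exact fun x _ => ENNReal.mul_ne_top (p.apply_ne_top x) ((q x).apply_ne_top y)
    · intro x hx
      have : p x = 0 := by
        rw [PMF.apply_eq_zero_iff]
        exact fun h => hx (hps h)
      simp [this]
  rw [expect_eq_sum hpu, expect_eq_sum hps]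
  simp only [hval, Finset.sum_mul]
  rw [Finset.sum_comm]
  refine Finset.sum_congr rfl fun x hx => ?_
  rw [expect_eq_sum (hqu x hx), Finset.mul_sum]
  exact Finset.sum_congr rfl fun y _ => by ring

lemma expect_map {p : PMF α} (hp : p.support.Finite) (g : α → β) (f : β → ℝ) :
    expect (p.map g) f = expect p (f ∘ g) := by
  rw [PMF.map, expect_bind hp (fun x => by simp)]
  simp only [Function.comp_apply, expect_pure]
  rfl

lemma expect_mono {p : PMF α} (hp : p.support.Finite) {f g : α → ℝ} (h : ∀ x, f x ≤ g x) :
    expect p f ≤ expect p g := by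
  have hs : p.support ⊆ hp.toFinset := by simp
  rw [expect_eq_sum hs, expect_eq_sum hs]
  exact Finset.sum_le_sum fun x _ => mul_le_mul_of_nonneg_left (h x) ENNReal.toReal_nonneg

lemma summable_toReal (p : PMF α) : Summable fun x => (p x).toReal :=
  ENNReal.summable_toReal p.tsum_coe_ne_top

lemma tsum_toReal (p : PMF α) : ∑' x, (p x).toReal = 1 := by
  rw [← ENNReal.tsum_toReal_eq p.apply_ne_top, p.tsum_coe, ENNReal.toReal_one]

lemma expect_const (p : PMF α) (c : ℝ) : expect p (fun _ => c) = c := by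
  rw [expect, tsum_mul_right, tsum_toReal, one_mul]

/-- An upper bound on the values bounds the expectation, even if the series diverges (its value is
then zero by convention). -/
lemma expect_le_of_le (p : PMF α) {f : α → ℝ} {c : ℝ} (hc : 0 ≤ c) (h : ∀ x, f x ≤ c) :
    expect p f ≤ c := by
  by_cases hf : Summable fun x => (p x).toReal * f x
  · rw [← expect_const p c]
    exact hf.tsum_le_tsum (fun x => mul_le_mul_of_nonneg_left (h x) ENNReal.toReal_nonneg)
      ((summable_toReal p).mul_right c)
  · rw [expect, tsum_eq_zero_of_not_summable hf]
    exact hc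

lemma expect_add {p : PMF α} (hp : p.support.Finite) (f g : α → ℝ) :
    expect p (fun x => f x + g x) = expect p f + expect p g := by
  have hs : p.support ⊆ hp.toFinset := by simp
  simp only [expect_eq_sum hs, mul_add, Finset.sum_add_distrib]

lemma expect_const_mul (p : PMF α) (c : ℝ) (f : α → ℝ) :
    expect p (fun x => c * f x) = c * expect p f := by
  simp only [expect, ← tsum_mul_left]
  exact tsum_congr fun x => by ring

variable {ι : Type*} [Fintype ι]

/-- The probability mass function with real weights `w`. -/
def simplexPMF (w : ι → ℝ) (hw : w ∈ stdSimplex ℝ ι) : PMF ι :=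
  PMF.ofFintype (fun i => ENNReal.ofReal (w i)) (by
    rw [← ENNReal.ofReal_sum_of_nonneg fun i _ => hw.1 i, hw.2, ENNReal.ofReal_one])

lemma expect_simplexPMF {w : ι → ℝ} (hw : w ∈ stdSimplex ℝ ι) (f : ι → ℝ) :
    expect (simplexPMF w hw) f = ∑ i, w i * f i := by
  rw [expect_eq_sum (s := Finset.univ) (by simp)]
  exact Finset.sum_congr rfl fun i _ => by
    rw [simplexPMF, PMF.ofFintype_apply, ENNReal.toReal_ofReal (hw.1 i)]

/-- The exponential weights `exp (G x) / ∑ x', exp (G x')` for the scores `G`. -/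
def expWeights (G : ι → ℝ) (x : ι) : ℝ := Real.exp (G x) / ∑ x', Real.exp (G x')

/-- Exponential weights mixed with the exploration distribution `π` at rate `γ`. -/
def mixedWeights (γ : ℝ) (π G : ι → ℝ) (x : ι) : ℝ := (1 - γ) * expWeights G x + γ * π x

lemma sum_exp_pos [Nonempty ι] (G : ι → ℝ) : 0 < ∑ x, Real.exp (G x) :=
  Finset.sum_pos (fun _ _ => Real.exp_pos _) Finset.univ_nonempty

lemma expWeights_nonneg (G : ι → ℝ) (x : ι) : 0 ≤ expWeights G x :=
  div_nonneg (Real.exp_pos _).le (Finset.sum_nonneg fun _ _ => (Real.exp_pos _).le)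

lemma sum_expWeights [Nonempty ι] (G : ι → ℝ) : ∑ x, expWeights G x = 1 := by
  simp only [expWeights, ← Finset.sum_div]
  exact div_self (sum_exp_pos G).ne'

lemma mixedWeights_mem_stdSimplex [Nonempty ι] {γ : ℝ} (h0 : 0 ≤ γ) (h1 : γ ≤ 1) {π : ι → ℝ}
    (hπ : π ∈ stdSimplex ℝ ι) (G : ι → ℝ) : mixedWeights γ π G ∈ stdSimplex ℝ ι := by
  refine ⟨fun x => add_nonneg (mul_nonneg (by linarith) (expWeights_nonneg G x))
    (mul_nonneg h0 (hπ.1 x)), ?_⟩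
  simp only [mixedWeights, Finset.sum_add_distrib, ← Finset.mul_sum, sum_expWeights, hπ.2]
  ring

lemma mul_le_mixedWeights {γ : ℝ} (h1 : γ ≤ 1) (π G : ι → ℝ) (x : ι) :
    γ * π x ≤ mixedWeights γ π G x :=
  le_add_of_nonneg_left (mul_nonneg (by linarith) (expWeights_nonneg G x))

lemma log_sum_exp_add_le [Nonempty ι] (G z : ι → ℝ) (hz : ∀ x, |z x| ≤ 1) :
    Real.log (∑ x, Real.exp (G x + z x)) ≤
      Real.log (∑ x, Real.exp (G x)) + ∑ x, expWeights G x * (z x + z x ^ 2) := by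
  have hS := sum_exp_pos G
  have hfac : ∑ x, Real.exp (G x + z x) =
      (∑ x, Real.exp (G x)) * ∑ x, expWeights G x * Real.exp (z x) := by
    rw [Finset.mul_sum]
    refine Finset.sum_congr rfl fun x _ => ?_
    rw [Real.exp_add, expWeights]
    field_simp
  have hpos : 0 < ∑ x, expWeights G x * Real.exp (z x) := by
    have := sum_exp_pos fun x => G x + z x
    rw [hfac] at this
    exact pos_of_mul_pos_right this hS.le
  rw [hfac, Real.log_mul hS.ne' hpos.ne']
  refine add_le_add_right ((Real.log_le_sub_one_of_pos hpos).trans ?_) _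
  rw [← sum_expWeights G, ← Finset.sum_sub_distrib]
  refine Finset.sum_le_sum fun x _ => ?_
  have := (abs_le.1 (Real.abs_exp_sub_one_sub_id_le (hz x))).2
  nlinarith [expWeights_nonneg G x]

/-- One round of exponential weights with estimated rewards: the expected growth of the
log-partition function is at most `η` times the expected reward, up to `η γ` for the exploration
and `2 η² V` for the variance of the estimates, where `η = γ / V`. -/
lemma expected_log_sum_exp_le [Nonempty ι] {V : ℕ} (hV : 1 ≤ V) {γ : ℝ} (h0 : 0 < γ)
    (h1 : γ ≤ 1 / 2) {π : ι → ℝ} (hπ : π ∈ stdSimplex ℝ ι) (G : ι → ℝ)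
    {k : ι → ι → ℝ} {r : ι → ℝ} (hr : ∀ x, r x ∈ Set.Icc (0 : ℝ) 1)
    (hk1 : ∀ x, ∑ a, mixedWeights γ π G a * (k a x * r a) = r x)
    (hk2 : ∀ a x, |k a x| ≤ V / γ)
    (hk3 : ∑ x, mixedWeights γ π G x * ∑ a, mixedWeights γ π G a * k a x ^ 2 ≤ V) :
    ∑ a, mixedWeights γ π G a *
        Real.log (∑ x, Real.exp (G x + γ / V * (k a x * r a))) ≤
      Real.log (∑ x, Real.exp (G x)) + γ / V * ∑ a, mixedWeights γ π G a * r a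
        + 3 * (γ / V) * γ := by
  set p := mixedWeights γ π G with hp
  set q := expWeights G with hq
  set η := γ / V with hη
  have hV0 : (0 : ℝ) < V := by exact_mod_cast hV
  have hη0 : 0 < η := by positivity
  have hηV : η * V = γ := by rw [hη]; field_simp
  have hps := mixedWeights_mem_stdSimplex h0.le (by linarith) hπ G
  rw [← hp] at hps
  have hz : ∀ a x, |η * (k a x * r a)| ≤ 1 := by
    intro a x
    rw [abs_mul, abs_mul, abs_of_pos hη0, abs_of_nonneg (hr a).1]
    have h3 : |k a x| * r a ≤ V / γ * 1 :=
      mul_le_mul (hk2 a x) (hr a).2 (hr a).1 (by positivity)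
    calc η * (|k a x| * r a) ≤ η * (V / γ * 1) := by gcongr
      _ = 1 := by rw [hη]; field_simp
  have hstep : ∀ a, Real.log (∑ x, Real.exp (G x + η * (k a x * r a))) ≤
      Real.log (∑ x, Real.exp (G x)) + (η * ∑ x, q x * (k a x * r a)
        + η ^ 2 * ∑ x, q x * k a x ^ 2) := by
    intro a
    refine (log_sum_exp_add_le G _ (hz a)).trans (add_le_add_right ?_ _)
    rw [Finset.mul_sum, Finset.mul_sum, ← Finset.sum_add_distrib]
    refine Finset.sum_le_sum fun x _ => ?_
    have hr2 : r a ^ 2 ≤ 1 := pow_le_one₀ (hr a).1 (hr a).2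
    have : η ^ 2 * (q x * (k a x ^ 2 * r a ^ 2)) ≤ η ^ 2 * (q x * (k a x ^ 2 * 1)) := by
      have := expWeights_nonneg G x
      gcongr
    linarith
  have hswap : ∀ f : ι → ι → ℝ,
      ∑ a, p a * ∑ x, q x * f a x = ∑ x, q x * ∑ a, p a * f a x := by
    intro f
    simp only [Finset.mul_sum]
    rw [Finset.sum_comm]
    exact Finset.sum_congr rfl fun x _ => Finset.sum_congr rfl fun a _ => by ring
  have hqr : ∑ x, q x * r x ≤ ∑ x, p x * r x + γ := by
    have h3 : ∑ x, q x * r x ≤ 1 := by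
      rw [← sum_expWeights G]
      exact Finset.sum_le_sum fun x _ =>
        mul_le_of_le_one_right (expWeights_nonneg G x) (hr x).2
    have h4 : ∑ x, p x * r x = (1 - γ) * ∑ x, q x * r x + γ * ∑ x, π x * r x := by
      rw [Finset.mul_sum, Finset.mul_sum, ← Finset.sum_add_distrib]
      exact Finset.sum_congr rfl fun x _ => by rw [hp, mixedWeights]; ring
    have h5 : 0 ≤ ∑ x, π x * r x := Finset.sum_nonneg fun x _ => mul_nonneg (hπ.1 x) (hr x).1
    nlinarith
  have hqk : ∑ x, q x * ∑ a, p a * k a x ^ 2 ≤ 2 * V := by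
    have h3 : ∑ x, q x * ∑ a, p a * k a x ^ 2 ≤ 2 * ∑ x, p x * ∑ a, p a * k a x ^ 2 := by
      rw [Finset.mul_sum]
      refine Finset.sum_le_sum fun x _ => ?_
      have hq2 : q x ≤ 2 * p x := by
        have h4 : p x = (1 - γ) * q x + γ * π x := rfl
        have := expWeights_nonneg G x
        have := mul_nonneg h0.le (hπ.1 x)
        nlinarith
      rw [← mul_assoc]
      exact mul_le_mul_of_nonneg_right hq2
        (Finset.sum_nonneg fun a _ => mul_nonneg (hps.1 a) (sq_nonneg _))
    linarith
  calc ∑ a, p a * Real.log (∑ x, Real.exp (G x + η * (k a x * r a)))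
      ≤ ∑ a, p a * (Real.log (∑ x, Real.exp (G x)) + (η * ∑ x, q x * (k a x * r a)
        + η ^ 2 * ∑ x, q x * k a x ^ 2)) :=
        Finset.sum_le_sum fun a _ => mul_le_mul_of_nonneg_left (hstep a) (hps.1 a)
    _ = (∑ a, p a) * Real.log (∑ x, Real.exp (G x))
        + η * ∑ a, p a * ∑ x, q x * (k a x * r a)
        + η ^ 2 * ∑ a, p a * ∑ x, q x * k a x ^ 2 := by
        simp only [mul_add, Finset.sum_add_distrib, Finset.sum_mul]
        rw [Finset.mul_sum, Finset.mul_sum, add_assoc]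
        congr 2 <;> exact Finset.sum_congr rfl fun a _ => by ring
    _ = Real.log (∑ x, Real.exp (G x)) + η * ∑ x, q x * r x
        + η ^ 2 * ∑ x, q x * ∑ a, p a * k a x ^ 2 := by
        rw [hps.2, one_mul, hswap fun a x => k a x * r a, hswap fun a x => k a x ^ 2]
        simp only [hk1]
    _ ≤ Real.log (∑ x, Real.exp (G x)) + η * (∑ x, p x * r x + γ) + η ^ 2 * (2 * V) := by
        gcongr
    _ = _ := by
        have : η ^ 2 * (2 * V) = 2 * η * γ := by rw [← hηV]; ring
        rw [this]; ring

end LinearBandit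

/-! ### Discretization of the menus -/

namespace TwoPartTariff

variable {H : ℝ} {ℓ K V : ℕ}

lemma payment_nonneg (ρ : Menu H ℓ) (o : Choice ℓ K) : 0 ≤ payment ρ o := by
  unfold payment
  split_ifs
  · exact add_nonneg (ρ o.1).1.2.1 (mul_nonneg (Nat.cast_nonneg _) (ρ o.1).2.2.1)
  · exact le_rfl

lemma historyRevenue_nonneg (h : History H ℓ K) : 0 ≤ historyRevenue h :=
  List.sum_nonneg fun _ hx => by
    obtain ⟨m, _, rfl⟩ := List.mem_map.1 hx
    exact payment_nonneg _ _

/-- A buyer may decline to buy, so she never pays more than her value. -/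
lemma IsBuyerChoice.payment_le (hℓ : 1 ≤ ℓ) {v : Fin (K + 1) → ℝ} (hv : IsValuation H v)
    {τ : Menu H ℓ → Choice ℓ K} (hτ : IsBuyerChoice v τ) (ρ : Menu H ℓ) :
    payment ρ (τ ρ) ≤ H := by
  have h := hτ ρ (⟨0, hℓ⟩, 0)
  have h1 : utility v ρ (⟨0, hℓ⟩, 0) = 0 := by simp [utility, payment, hv.zero]
  rw [h1, utility] at h
  linarith [(hv.mem_Icc (τ ρ).2).2]

/-- If every price is lowered by the factor `1 - ε`, up to an error `δ` in the buyer's favour, then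
dearer options get the larger discounts, so that no buyer moves to an option cheaper by more than
`δ / ε`, whatever her tie-breaking rule. -/
lemma IsBuyerChoice.payment_sub_le_of_discount (hℓ : 1 ≤ ℓ) {v : Fin (K + 1) → ℝ}
    (hv : IsValuation H v) {τ : Menu H ℓ → Choice ℓ K} (hτ : IsBuyerChoice v τ)
    {ε δ : ℝ} (hε : 0 < ε) (hε1 : ε ≤ 1) {ρ ρ' : Menu H ℓ}
    (hle : ∀ o : Choice ℓ K, payment ρ' o ≤ (1 - ε) * payment ρ o)
    (hge : ∀ o : Choice ℓ K, (1 - ε) * payment ρ o - δ ≤ payment ρ' o) :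
    payment ρ (τ ρ) - ε * H - δ / ε ≤ payment ρ' (τ ρ') := by
  have h1 := hτ ρ (τ ρ')
  have h2 := hτ ρ' (τ ρ)
  simp only [utility] at h1 h2
  have h3 := hle (τ ρ)
  have h4 := hge (τ ρ')
  have h5 : payment ρ (τ ρ) - δ / ε ≤ payment ρ (τ ρ') := by
    have : payment ρ (τ ρ) - payment ρ (τ ρ') ≤ δ / ε := by
      rw [le_div_iff₀ hε]
      nlinarith
    linarith
  have h6 := mul_le_mul_of_nonneg_left h5 (sub_nonneg.2 hε1)
  have h7 : (1 - ε) * (payment ρ (τ ρ) - δ / ε) =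
      payment ρ (τ ρ) - ε * payment ρ (τ ρ) - δ / ε + δ := by
    field_simp
    ring
  have h8 := mul_le_mul_of_nonneg_left (hτ.payment_le hℓ hv ρ) hε.le
  linarith

/-- The point `H i / m` of the regular grid with `m + 1` points on `[0, H]`. -/
def gridPoint (hH : 0 ≤ H) (m : ℕ) (i : Fin (m + 1)) : Set.Icc (0 : ℝ) H :=
  ⟨H * (i / m), by positivity, by
    refine mul_le_of_le_one_right hH (div_le_one_of_le₀ ?_ (Nat.cast_nonneg m))
    exact_mod_cast Nat.lt_succ_iff.1 i.2⟩

lemma exists_gridPoint (hH : 0 < H) {m : ℕ} (hm : 0 < m) {x : ℝ} (hx : x ∈ Set.Icc (0 : ℝ) H) :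
    ∃ i : Fin (m + 1), (gridPoint hH.le m i : ℝ) ≤ x ∧ x - H / m ≤ gridPoint hH.le m i := by
  have hm0 : (0 : ℝ) < m := by exact_mod_cast hm
  have hy0 : 0 ≤ x * m / H := div_nonneg (mul_nonneg hx.1 hm0.le) hH.le
  have hy1 : x * m / H ≤ m := by
    rw [div_le_iff₀ hH]
    nlinarith [hx.2]
  have hlt : ⌊x * m / H⌋₊ < m + 1 := Nat.lt_succ_iff.2 (Nat.floor_le_of_le hy1)
  refine ⟨⟨⌊x * m / H⌋₊, hlt⟩, ?_, ?_⟩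
  · have := Nat.floor_le hy0
    calc H * ((⌊x * m / H⌋₊ : ℝ) / m) ≤ H * (x * m / H / m) := by gcongr
      _ = x := by field_simp
  · have := (Nat.lt_floor_add_one (x * m / H)).le
    have h2 : H * (x * m / H / m) ≤ H * (((⌊x * m / H⌋₊ : ℝ) + 1) / m) := by gcongr
    have h3 : H * (x * m / H / m) = x := by field_simp
    have h4 : H * (((⌊x * m / H⌋₊ : ℝ) + 1) / m) = H * ((⌊x * m / H⌋₊ : ℝ) / m) + H / m := by
      ring
    simp only [gridPoint]
    linarith

/-- The menus whose up-front fees are multiples of `H / n` and whose per-unit fees are multiples of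
`H / (n K)`. -/
def gridMenu (hH : 0 ≤ H) (K n : ℕ) (g : Fin ℓ → Fin (n + 1) × Fin (n * K + 1)) : Menu H ℓ :=
  fun j => (gridPoint hH n (g j).1, gridPoint hH (n * K) (g j).2)

lemma exists_gridMenu_discount (hH : 0 < H) (hK : 1 ≤ K) {n : ℕ} (hn : 1 ≤ n) {ε : ℝ}
    (hε : 0 ≤ ε) (hε1 : ε ≤ 1) (ρ : Menu H ℓ) :
    ∃ g : Fin ℓ → Fin (n + 1) × Fin (n * K + 1), ∀ o : Choice ℓ K,
      payment (gridMenu hH.le K n g) o ≤ (1 - ε) * payment ρ o ∧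
      (1 - ε) * payment ρ o - 2 * H / n ≤ payment (gridMenu hH.le K n g) o := by
  have hmem : ∀ x : Set.Icc (0 : ℝ) H, (1 - ε) * (x : ℝ) ∈ Set.Icc (0 : ℝ) H := fun x =>
    ⟨mul_nonneg (by linarith) x.2.1, by nlinarith [x.2.1, x.2.2]⟩
  choose i hi1 hi2 using fun j => exists_gridPoint hH hn (hmem (ρ j).1)
  choose i' hi1' hi2' using fun j =>
    exists_gridPoint hH (Nat.mul_pos hn hK) (hmem (ρ j).2)
  have hn0 : (0 : ℝ) < n := by exact_mod_cast hn
  have hK0 : (0 : ℝ) < K := by exact_mod_cast hK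
  refine ⟨fun j => (i j, i' j), fun o => ?_⟩
  unfold payment gridMenu
  split_ifs
  · have ho : ((o.2 : ℕ) : ℝ) ≤ K := by exact_mod_cast Nat.lt_succ_iff.1 o.2.2
    have ho0 : (0 : ℝ) ≤ ((o.2 : ℕ) : ℝ) := Nat.cast_nonneg _
    have h1 := mul_le_mul_of_nonneg_left (hi1' o.1) ho0
    have h2 := mul_le_mul_of_nonneg_left (hi2' o.1) ho0
    have h3 : ((o.2 : ℕ) : ℝ) * (H / (n * K : ℕ)) ≤ H / n := by
      calc ((o.2 : ℕ) : ℝ) * (H / (n * K : ℕ)) ≤ K * (H / (n * K : ℕ)) := by gcongr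
        _ = H / n := by push_cast; field_simp
    have h4 := hi1 o.1
    have h5 := hi2 o.1
    have h6 : 2 * H / n = H / n + H / n := by ring
    constructor <;> dsimp only <;> linarith
  · simp only [mul_zero, le_refl, true_and, zero_sub]
    have : 0 ≤ 2 * H / n := by positivity
    linarith

/-- Grid menus lose at most `3 H / √T` per buyer against any menu. -/
lemma exists_gridMenu_revenue_ge (hH : 0 < H) (hℓ : 1 ≤ ℓ) (hK : 1 ≤ K) {T : ℕ} (hT : 1 ≤ T)
    {v : Fin V → Fin (K + 1) → ℝ} (hv : ∀ i, IsValuation H (v i))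
    {σ : Fin V → Menu H ℓ → Choice ℓ K} (hσ : ∀ i, IsBuyerChoice (v i) (σ i)) (ρ : Menu H ℓ) :
    ∃ g : Fin ℓ → Fin (T + 1) × Fin (T * K + 1), ∀ i,
      payment ρ (σ i ρ) - 3 * H / √T ≤
        payment (gridMenu hH.le K T g) (σ i (gridMenu hH.le K T g)) := by
  have hT1 : (1 : ℝ) ≤ T := by exact_mod_cast hT
  have hs : 1 ≤ √(T : ℝ) := Real.one_le_sqrt.2 hT1
  have hss : √(T : ℝ) * √(T : ℝ) = T := Real.mul_self_sqrt (by linarith)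
  have hs0 : 0 < √(T : ℝ) := by linarith
  obtain ⟨g, hg⟩ := exists_gridMenu_discount hH hK hT (ε := 1 / √T) (by positivity)
    ((div_le_one hs0).2 hs) ρ
  refine ⟨g, fun i => ?_⟩
  have h := (hσ i).payment_sub_le_of_discount hℓ (hv i) (ε := 1 / √T) (by positivity)
    ((div_le_one hs0).2 hs) (fun o => (hg o).1) (fun o => (hg o).2)
  have h2 : 1 / √(T : ℝ) * H + 2 * H / T / (1 / √(T : ℝ)) = 3 * H / √T := by
    generalize √(T : ℝ) = s at hss hs0
    rw [← hss]
    field_simp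
    ring
  linarith

end TwoPartTariff

/-! ### The online algorithm -/

namespace TwoPartTariff

open LinearBandit

variable {H : ℝ} {ℓ K V : ℕ}

section Algorithm

variable {ι : Type}

/-- The scores after a history: the sum over the past rounds of `η` times the estimated normalized
rewards.  The kernel `k` of a round may depend on the scores before that round, and the played menu
`e a` is decoded to its index `a`. -/
def estimatedScore [Nonempty ι] (e : ι → Menu H ℓ) (η : ℝ) (k : (ι → ℝ) → ι → ι → ℝ)
    (h : History H ℓ K) : ι → ℝ :=
  h.foldl (fun G m x => G x + η * (k G (Function.invFun e m.1) x * (payment m.1 m.2 / H))) 0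

/-- Exponential weights on the estimated rewards of the menus `e i`, mixed with the exploration
distribution `π` at rate `γ`. -/
def expWeightsAlgorithm [Fintype ι] [Nonempty ι] (e : ι → Menu H ℓ) (η : ℝ)
    (k : (ι → ℝ) → ι → ι → ℝ) {γ : ℝ} (h0 : 0 ≤ γ) (h1 : γ ≤ 1) {π : ι → ℝ}
    (hπ : π ∈ stdSimplex ℝ ι) : BanditAlgorithm H ℓ K := fun h =>
  (simplexPMF _ (mixedWeights_mem_stdSimplex h0 h1 hπ (estimatedScore e η k h))).map e

lemma estimatedScore_append [Nonempty ι] {e : ι → Menu H ℓ} (he : Function.Injective e) (η : ℝ)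
    (k : (ι → ℝ) → ι → ι → ℝ) (h : History H ℓ K) (a : ι) (o : Choice ℓ K) :
    estimatedScore e η k (h ++ [(e a, o)]) = fun x => estimatedScore e η k h x
      + η * (k (estimatedScore e η k h) a x * (payment (e a) o / H)) := by
  simp [estimatedScore, Function.leftInverse_invFun he a]

variable [Fintype ι]

lemma finite_support_map (p : PMF ι) {α : Type*} (f : ι → α) : (p.map f).support.Finite := by
  rw [PMF.support_map]
  exact (Set.toFinite _).image f

variable [Nonempty ι]

lemma finite_support_historyLaw (e : ι → Menu H ℓ) (η : ℝ) (k : (ι → ℝ) → ι → ι → ℝ) {γ : ℝ}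
    (h0 : 0 ≤ γ) (h1 : γ ≤ 1) {π : ι → ℝ} (hπ : π ∈ stdSimplex ℝ ι)
    (σ : Fin V → Menu H ℓ → Choice ℓ K) (b : ℕ → Fin V) (t : ℕ) :
    (historyLaw (expWeightsAlgorithm e η k h0 h1 hπ) σ b t).support.Finite := by
  induction t with
  | zero => simp [historyLaw]
  | succ t ih =>
    rw [historyLaw, PMF.support_bind]
    refine ih.biUnion fun h _ => ?_
    rw [expWeightsAlgorithm, PMF.map_comp]
    exact finite_support_map _ _

lemma expect_historyLaw_succ (e : ι → Menu H ℓ) (η : ℝ) (k : (ι → ℝ) → ι → ι → ℝ) {γ : ℝ}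
    (h0 : 0 ≤ γ) (h1 : γ ≤ 1) {π : ι → ℝ} (hπ : π ∈ stdSimplex ℝ ι)
    (σ : Fin V → Menu H ℓ → Choice ℓ K) (b : ℕ → Fin V) (t : ℕ) (f : History H ℓ K → ℝ) :
    expect (historyLaw (expWeightsAlgorithm e η k h0 h1 hπ) σ b (t + 1)) f =
      expect (historyLaw (expWeightsAlgorithm e η k h0 h1 hπ) σ b t) fun h =>
        ∑ a, mixedWeights γ π (estimatedScore e η k h) a * f (h ++ [(e a, σ (b t) (e a))]) := by
  rw [historyLaw, expect_bind (finite_support_historyLaw e η k h0 h1 hπ σ b t)]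
  · congr 1
    funext h
    rw [expWeightsAlgorithm, PMF.map_comp, expect_map (Set.toFinite _), expect_simplexPMF]
    rfl
  · intro h
    rw [expWeightsAlgorithm, PMF.map_comp]
    exact finite_support_map _ _

/-- A regret bound against finitely many menus: the rewards of a menu form a vector with one entry
per buyer type, so the problem is a linear bandit in dimension at most `V`. -/
theorem exists_algorithm_finite (hH : 0 < H) (hℓ : 1 ≤ ℓ) (hV : 1 ≤ V)
    {v : Fin V → Fin (K + 1) → ℝ} (hv : ∀ i, IsValuation H (v i))
    {σ : Fin V → Menu H ℓ → Choice ℓ K} (hσ : ∀ i, IsBuyerChoice (v i) (σ i))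
    {e : ι → Menu H ℓ} (he : Function.Injective e) {γ : ℝ} (h0 : 0 < γ) (h1 : γ ≤ 1 / 2) :
    ∃ A : BanditAlgorithm H ℓ K, ∀ (b : ℕ → Fin V) (T : ℕ),
      (historyLaw A σ b T).support.Finite ∧ ∀ x,
      ∑ t ∈ Finset.range T, payment (e x) (σ (b t) (e x)) -
          H * (V * Real.log (Fintype.card ι) / γ + 3 * γ * T) ≤
        expect (historyLaw A σ b T) historyRevenue := by
  classical
  set r : ι → Fin V → ℝ := fun a j => payment (e a) (σ j (e a)) / H with hr
  have hr01 : ∀ j a, r a j ∈ Set.Icc (0 : ℝ) 1 := fun j a =>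
    ⟨div_nonneg (payment_nonneg _ _) hH.le,
      (div_le_one hH).2 ((hσ j).payment_le hℓ (hv j) _)⟩
  obtain ⟨π, hπ, hest⟩ := exists_estimator r
  choose k hk1 hk2 hk3 using fun G : ι → ℝ =>
    hest γ h0 (mixedWeights γ π G) (mul_le_mixedWeights (by linarith) π G)
  set η : ℝ := γ / V with hη
  have hV0 : (0 : ℝ) < V := by exact_mod_cast hV
  have hη0 : 0 < η := by positivity
  refine ⟨expWeightsAlgorithm e η k h0.le (by linarith) hπ, fun b T =>
    ⟨finite_support_historyLaw e η k _ _ hπ σ b T, fun x => ?_⟩⟩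
  set L := historyLaw (expWeightsAlgorithm e η k h0.le (by linarith) hπ) σ b with hL
  have hfin : ∀ t, (L t).support.Finite := finite_support_historyLaw e η k _ _ hπ σ b
  -- The potential compares the log-partition function with the score of the comparator `x` and
  -- with the revenue; its expected growth per round is controlled by the comparator's reward.
  let Ψ : History H ℓ K → ℝ := fun h =>
    Real.log (∑ y, Real.exp (estimatedScore e η k h y)) +
      -(estimatedScore e η k h x + η * (historyRevenue h / H))
  have hΨ : ∀ t, expect (L t) Ψ ≤ Real.log (Fintype.card ι) +
      (t * (3 * η * γ) - η * ∑ s ∈ Finset.range t, r x (b s)) := by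
    intro t
    induction t with
    | zero =>
      simp [hL, historyLaw, expect_pure, Ψ, estimatedScore, historyRevenue]
    | succ t ih =>
      rw [hL, expect_historyLaw_succ, ← hL]
      have hstep : ∀ h, ∑ a, mixedWeights γ π (estimatedScore e η k h) a *
          Ψ (h ++ [(e a, σ (b t) (e a))]) ≤ Ψ h + (3 * η * γ - η * r x (b t)) := by
        intro h
        set G := estimatedScore e η k h with hG
        have hp := mixedWeights_mem_stdSimplex h0.le (by linarith) hπ G
        have hmain := expected_log_sum_exp_le hV h0 h1 hπ G (hr01 (b t)) (fun x => hk1 G x (b t))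
          (hk2 G) (hk3 G)
        have hrev : ∀ a, historyRevenue (h ++ [(e a, σ (b t) (e a))]) / H =
            historyRevenue h / H + r a (b t) := by
          intro a
          simp [historyRevenue, hr, add_div]
        have heq : ∑ a, mixedWeights γ π G a * Ψ (h ++ [(e a, σ (b t) (e a))]) =
            ∑ a, mixedWeights γ π G a *
              Real.log (∑ y, Real.exp (G y + η * (k G a y * r a (b t)))) -
            ((∑ a, mixedWeights γ π G a) * (G x + η * (historyRevenue h / H)) +
              η * ∑ a, mixedWeights γ π G a * (k G a x * r a (b t)) +
              η * ∑ a, mixedWeights γ π G a * r a (b t)) := by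
          rw [Finset.sum_mul, Finset.mul_sum, Finset.mul_sum, ← Finset.sum_add_distrib,
            ← Finset.sum_add_distrib, ← Finset.sum_sub_distrib]
          refine Finset.sum_congr rfl fun a _ => ?_
          simp only [Ψ, estimatedScore_append he, hrev, ← hG]
          simp only [hr]
          ring
        rw [heq, hp.2, hk1]
        have hΨh : Ψ h = Real.log (∑ y, Real.exp (G y)) +
          -(G x + η * (historyRevenue h / H)) := rfl
        rw [hΨh]
        linarith
      refine (expect_mono (hfin t) hstep).trans ?_
      rw [expect_add (hfin t), expect_const, Finset.sum_range_succ]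
      push_cast
      linarith
  have hge : ∀ h, -(η / H) * historyRevenue h ≤ Ψ h := by
    intro h
    have : estimatedScore e η k h x ≤ Real.log (∑ y, Real.exp (estimatedScore e η k h y)) := by
      rw [Real.le_log_iff_exp_le (sum_exp_pos _)]
      exact Finset.single_le_sum (f := fun y => Real.exp (estimatedScore e η k h y))
        (fun _ _ => (Real.exp_pos _).le) (Finset.mem_univ x)
    have h2 : -(η / H) * historyRevenue h = -(η * (historyRevenue h / H)) := by ring
    simp only [Ψ]
    linarith
  have hfinal := (expect_mono (hfin T) hge).trans (hΨ T)
  rw [expect_const_mul] at hfinal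
  have hsum : ∑ t ∈ Finset.range T, payment (e x) (σ (b t) (e x)) =
      H * ∑ t ∈ Finset.range T, r x (b t) := by
    rw [Finset.mul_sum]
    refine Finset.sum_congr rfl fun t _ => ?_
    simp only [hr]
    field_simp
  rw [hsum]
  set E := expect (L T) historyRevenue
  set R := ∑ t ∈ Finset.range T, r x (b t)
  have h3 : η / H * (H * R - E) ≤
      η / H * (H * (V * Real.log (Fintype.card ι) / γ + 3 * γ * T)) := by
    have h4 : η / H * (H * R - E) = η * R - η / H * E := by field_simp
    have h5 : η / H * (H * (V * Real.log (Fintype.card ι) / γ + 3 * γ * T)) =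
        Real.log (Fintype.card ι) + T * (3 * η * γ) := by
      rw [hη]
      field_simp
    rw [h4, h5]
    linarith
  have := le_of_mul_le_mul_left h3 (by positivity)
  linarith

end Algorithm

lemma expectedRegret_le_mul (hH : 0 < H) (hℓ : 1 ≤ ℓ)
    {v : Fin V → Fin (K + 1) → ℝ} (hv : ∀ i, IsValuation H (v i))
    {σ : Fin V → Menu H ℓ → Choice ℓ K} (hσ : ∀ i, IsBuyerChoice (v i) (σ i))
    (A : BanditAlgorithm H ℓ K) (b : ℕ → Fin V) (T : ℕ) :
    expectedRegret A σ b T ≤ H * T := by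
  have hne : Nonempty (Menu H ℓ) := ⟨fun _ => (⟨0, le_rfl, hH.le⟩, ⟨0, le_rfl, hH.le⟩)⟩
  refine expect_le_of_le _ (by positivity) fun h => ?_
  have : bestRevenue σ b T ≤ H * T := by
    refine ciSup_le fun ρ => ?_
    refine (Finset.sum_le_sum fun t _ => (hσ (b t)).payment_le hℓ (hv (b t)) ρ).trans ?_
    simp [mul_comm]
  linarith [historyRevenue_nonneg h]

lemma log_card_grid_le {T : ℕ} (hℓ : 1 ≤ ℓ) (hK : 1 ≤ K) (hT : 1 ≤ T) :
    Real.log (Fintype.card (Fin ℓ → Fin (T + 1) × Fin (T * K + 1))) ≤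
      3 * ℓ ^ 2 * (1 + Real.log T) ^ 2 * (K : ℝ) ^ (2 / 3 : ℝ) := by
  have hT1 : (1 : ℝ) ≤ T := by exact_mod_cast hT
  have hK1 : (1 : ℝ) ≤ K := by exact_mod_cast hK
  have hℓ1 : (1 : ℝ) ≤ ℓ := by exact_mod_cast hℓ
  have hlT := Real.log_nonneg hT1
  have hlK := Real.log_nonneg hK1
  have hTK : (1 : ℝ) ≤ T * K := one_le_mul_of_one_le_of_one_le hT1 hK1
  have h1 : Real.log (Fintype.card (Fin ℓ → Fin (T + 1) × Fin (T * K + 1))) =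
      ℓ * (Real.log (T + 1) + Real.log (T * K + 1)) := by
    simp only [Fintype.card_fun, Fintype.card_prod, Fintype.card_fin]
    push_cast
    rw [Real.log_pow, Real.log_mul (by positivity) (by positivity)]
  have h2 : ∀ y : ℝ, 1 ≤ y → Real.log (y + 1) ≤ 1 + Real.log y := by
    intro y hy
    have : Real.log (y + 1) ≤ Real.log (2 * y) := Real.log_le_log (by linarith) (by linarith)
    rw [Real.log_mul (by norm_num) (by linarith)] at this
    linarith [Real.log_two_lt_d9]
  have h3 : 1 + Real.log K ≤ 3 / 2 * (K : ℝ) ^ (2 / 3 : ℝ) := by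
    have h4 := Real.log_le_sub_one_of_pos (Real.rpow_pos_of_pos (by linarith : (0 : ℝ) < K) (2 / 3))
    rw [Real.log_rpow (by linarith)] at h4
    linarith
  have h5 := h2 _ hT1
  have h6 := h2 _ hTK
  rw [Real.log_mul (by linarith) (by linarith)] at h6
  have hK23 : 0 ≤ (K : ℝ) ^ (2 / 3 : ℝ) := by positivity
  rw [h1]
  calc ℓ * (Real.log (T + 1) + Real.log (T * K + 1))
      ≤ ℓ * (2 * (1 + Real.log T) ^ 2 * (1 + Real.log K)) := by
        refine mul_le_mul_of_nonneg_left ?_ (by linarith)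
        nlinarith [mul_nonneg hlT hlK, mul_nonneg (mul_nonneg hlT hlT) hlK, sq_nonneg (Real.log T)]
    _ ≤ (ℓ : ℝ) ^ 2 * (2 * (1 + Real.log T) ^ 2 * (1 + Real.log K)) := by
        refine mul_le_mul_of_nonneg_right ?_ (by positivity)
        nlinarith
    _ ≤ (ℓ : ℝ) ^ 2 * (2 * (1 + Real.log T) ^ 2 * (3 / 2 * (K : ℝ) ^ (2 / 3 : ℝ))) := by gcongr
    _ = _ := by ring

/-- A regret bound that has the natural scaling in `H` and grows with `√(V T)`, the rate of linear
bandits in dimension `V`. -/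
theorem exists_algorithm_sqrt {T : ℕ} (hH : 0 < H) (hℓ : 1 ≤ ℓ) (hK : 1 ≤ K) (hV : 1 ≤ V)
    (hT : 1 ≤ T) {v : Fin V → Fin (K + 1) → ℝ} (hv : ∀ i, IsValuation H (v i))
    {σ : Fin V → Menu H ℓ → Choice ℓ K} (hσ : ∀ i, IsBuyerChoice (v i) (σ i)) :
    ∃ A : BanditAlgorithm H ℓ K, ∀ b : ℕ → Fin V,
      expectedRegret A σ b T ≤
        H * (11 * ((1 + Real.log T) * √(T * V) * ℓ * (K : ℝ) ^ (1 / 3 : ℝ))) := by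
  classical
  have hT1 : (1 : ℝ) ≤ T := by exact_mod_cast hT
  have hK1 : (1 : ℝ) ≤ K := by exact_mod_cast hK
  have hℓ1 : (1 : ℝ) ≤ ℓ := by exact_mod_cast hℓ
  have hV1 : (1 : ℝ) ≤ V := by exact_mod_cast hV
  have hlT := Real.log_nonneg hT1
  have hne : Nonempty (Menu H ℓ) := ⟨fun _ => (⟨0, le_rfl, hH.le⟩, ⟨0, le_rfl, hH.le⟩)⟩
  set Q : ℝ := (1 + Real.log T) * ℓ * (K : ℝ) ^ (1 / 3 : ℝ) with hQ
  have hQ1 : 1 ≤ Q := by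
    have : 1 ≤ (K : ℝ) ^ (1 / 3 : ℝ) := Real.one_le_rpow hK1 (by norm_num)
    exact one_le_mul_of_one_le_of_one_le
      (one_le_mul_of_one_le_of_one_le (by linarith) hℓ1) this
  set s := √(T : ℝ) with hs
  set w := √(V : ℝ) with hw
  have hss : s * s = T := Real.mul_self_sqrt (by linarith)
  have hww : w * w = V := Real.mul_self_sqrt (by linarith)
  have hs1 : 1 ≤ s := Real.one_le_sqrt.2 hT1
  have hw1 : 1 ≤ w := Real.one_le_sqrt.2 hV1
  have hgoal : 11 * ((1 + Real.log T) * √(T * V) * ℓ * (K : ℝ) ^ (1 / 3 : ℝ)) =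
      11 * (s * w * Q) := by
    rw [Real.sqrt_mul (by linarith), hQ]
    ring
  rw [hgoal]
  -- The exploration rate balances `V log N / γ` against `γ T`.
  set γ : ℝ := w * Q / s with hγ
  have hγ0 : 0 < γ := by positivity
  rcases le_or_gt γ (1 / 2) with h1 | h1
  swap
  -- A rate above `1/2` means that `√T < 2 w Q`, and the trivial bound `H T` is good enough.
  · refine ⟨fun _ => PMF.pure hne.some, fun b =>
      (expectedRegret_le_mul hH hℓ hv hσ _ b T).trans ?_⟩
    rw [hγ, lt_div_iff₀ (by linarith)] at h1
    rw [← hss]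
    refine mul_le_mul_of_nonneg_left ?_ hH.le
    nlinarith
  let S : Finset (Menu H ℓ) := Finset.univ.image (gridMenu hH.le K T)
  have hmemS : ∀ g, gridMenu hH.le K T g ∈ S := fun g =>
    Finset.mem_image_of_mem _ (Finset.mem_univ g)
  have hSne : Nonempty S := ⟨⟨_, hmemS fun _ => (0, 0)⟩⟩
  have hlog : Real.log (Fintype.card S) ≤ 3 * Q ^ 2 := by
    have hcard : Fintype.card S ≤ Fintype.card (Fin ℓ → Fin (T + 1) × Fin (T * K + 1)) := by
      rw [Fintype.card_coe]
      exact Finset.card_image_le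
    have hpos : (0 : ℝ) < Fintype.card S := by exact_mod_cast Fintype.card_pos
    refine (Real.log_le_log hpos (by exact_mod_cast hcard)).trans
      ((log_card_grid_le hℓ hK hT).trans_eq ?_)
    have : (K : ℝ) ^ (2 / 3 : ℝ) = ((K : ℝ) ^ (1 / 3 : ℝ)) ^ 2 := by
      rw [← Real.rpow_natCast, ← Real.rpow_mul (by linarith)]
      norm_num
    rw [this, hQ]
    ring
  obtain ⟨A, hA⟩ := exists_algorithm_finite hH hℓ hV hv hσ
    (e := ((↑) : S → Menu H ℓ)) Subtype.val_injective hγ0 h1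
  refine ⟨A, fun b => ?_⟩
  obtain ⟨hfin, hreg⟩ := hA b T
  have hbest : bestRevenue σ b T ≤ expect (historyLaw A σ b T) historyRevenue +
      H * (V * Real.log (Fintype.card S) / γ + 3 * γ * T) + 3 * H * s := by
    refine ciSup_le fun ρ => ?_
    obtain ⟨g, hg⟩ := exists_gridMenu_revenue_ge hH hℓ hK hT hv hσ ρ
    have h2 := hreg ⟨_, hmemS g⟩
    have h3 : ∑ t ∈ Finset.range T, (payment ρ (σ (b t) ρ) - 3 * H / √T) ≤ _ :=
      Finset.sum_le_sum fun t _ => hg (b t)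
    rw [Finset.sum_sub_distrib, Finset.sum_const, Finset.card_range, nsmul_eq_mul] at h3
    have h4 : T * (3 * H / √(T : ℝ)) = 3 * H * s := by
      rw [← hs, ← hss]
      field_simp
    linarith
  have hER : expectedRegret A σ b T =
      bestRevenue σ b T - expect (historyLaw A σ b T) historyRevenue := by
    have h2 : expectedRegret A σ b T = expect (historyLaw A σ b T)
        fun h => bestRevenue σ b T + -1 * historyRevenue h := by
      unfold expectedRegret expect
      exact tsum_congr fun h => by ring
    rw [h2, expect_add hfin, expect_const, expect_const_mul]
    ring
  have hb1 : V * Real.log (Fintype.card S) / γ ≤ 3 * (s * w * Q) := by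
    calc V * Real.log (Fintype.card S) / γ ≤ V * (3 * Q ^ 2) / γ := by gcongr
      _ = 3 * (s * w * Q) := by rw [hγ, ← hww]; field_simp
  have hb2 : 3 * γ * T = 3 * (s * w * Q) := by rw [hγ, ← hss]; field_simp
  have hb3 : s ≤ s * w * Q := by
    rw [mul_assoc]
    exact le_mul_of_one_le_right (by linarith) (one_le_mul_of_one_le_of_one_le hw1 hQ1)
  rw [hER]
  have hb4 : V * Real.log (Fintype.card S) / γ + 3 * γ * T + 3 * s ≤ 11 * (s * w * Q) := by
    linarith
  have := mul_le_mul_of_nonneg_left hb4 hH.le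
  linarith

end TwoPartTariff

/-! ### Comparison of the rates -/

namespace TwoPartTariff

/-- The linear-bandit bound `H √(T V)` is within the rate `T ^ (2/3) (H V) ^ (1/3)` when
`H ^ 4 V ≤ T`, which is also necessary for it. -/
lemma mul_sqrt_le_rpow {H T V : ℝ} (hH : 0 < H) (hT : 0 < T) (hV : 0 < V) (h : H ^ 4 * V ≤ T) :
    H * √(T * V) ≤ T ^ (2 / 3 : ℝ) * H ^ (1 / 3 : ℝ) * V ^ (1 / 3 : ℝ) := by
  -- Compare sixth powers: `H ^ 6 T ^ 3 V ^ 3 ≤ T ^ 4 H ^ 2 V ^ 2`.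
  refine le_of_pow_le_pow_left₀ (n := 6) (by norm_num) (by positivity) ?_
  have h1 : √(T * V) ^ 6 = (T * V) ^ 3 := by
    rw [show 6 = 2 * 3 from rfl, pow_mul, Real.sq_sqrt (by positivity)]
  have h2 : ∀ x : ℝ, 0 < x → (x ^ (1 / 3 : ℝ)) ^ 6 = x ^ 2 := fun x hx => by
    rw [← Real.rpow_natCast, ← Real.rpow_mul hx.le, ← Real.rpow_natCast]
    norm_num
  have h3 : (T ^ (2 / 3 : ℝ)) ^ 6 = T ^ 4 := by
    rw [← Real.rpow_natCast, ← Real.rpow_mul hT.le, ← Real.rpow_natCast]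
    norm_num
  rw [mul_pow, h1, mul_pow (_ * _) _ 6, mul_pow _ (H ^ _), h2 H hH, h2 V hV, h3]
  calc H ^ 6 * (T * V) ^ 3 = T ^ 3 * H ^ 2 * V ^ 2 * (H ^ 4 * V) := by ring
    _ ≤ T ^ 3 * H ^ 2 * V ^ 2 * T := by gcongr
    _ = T ^ 4 * H ^ 2 * V ^ 2 := by ring

end TwoPartTariff

end

theorem mainTheorem8 :
    ∃ (C : ℝ) (c : ℕ), 0 < C ∧
      ∀ (H : ℝ) (ℓ K V T : ℕ), 0 < H → 1 ≤ ℓ → 1 ≤ K → 1 ≤ V → 1 ≤ T →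
      ∀ (v : Fin V → Fin (K + 1) → ℝ), (∀ i, TwoPartTariff.IsValuation H (v i)) →
      ∀ (σ : Fin V → TwoPartTariff.Menu H ℓ → TwoPartTariff.Choice ℓ K),
        (∀ i, TwoPartTariff.IsBuyerChoice (v i) (σ i)) →
      ∃ A : TwoPartTariff.BanditAlgorithm H ℓ K, ∀ b : ℕ → Fin V,
        (H ≤ 1 ∨ H ^ 4 * V ≤ T →
          TwoPartTariff.expectedRegret A σ b T ≤
            C * (1 + Real.log T) ^ c * TwoPartTariff.regretRate H ℓ K V T) ∧
        TwoPartTariff.expectedRegret A σ b T ≤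
          max 1 H ^ (2 / 3 : ℝ) *
            (C * (1 + Real.log T) ^ c * TwoPartTariff.regretRate H ℓ K V T) := by
  refine ⟨22, 1, by norm_num, fun H ℓ K V T hH hℓ hK hV hT v hv σ hσ => ?_⟩
  obtain ⟨A, hA⟩ := TwoPartTariff.exists_algorithm_sqrt hH hℓ hK hV hT hv hσ
  refine ⟨A, fun b => ?_⟩
  have hT1 : (1 : ℝ) ≤ T := by exact_mod_cast hT
  have hK1 : (1 : ℝ) ≤ K := by exact_mod_cast hK
  have hℓ1 : (1 : ℝ) ≤ ℓ := by exact_mod_cast hℓ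
  have hV1 : (1 : ℝ) ≤ V := by exact_mod_cast hV
  have hlT := Real.log_nonneg hT1
  set Q : ℝ := (1 + Real.log T) * ℓ * (K : ℝ) ^ (1 / 3 : ℝ) with hQ
  have hQ1 : 1 ≤ Q :=
    one_le_mul_of_one_le_of_one_le (one_le_mul_of_one_le_of_one_le (by linarith) hℓ1)
      (Real.one_le_rpow hK1 (by norm_num))
  -- The logarithmic factor of the rate is at least `(log 2) ^ (1/3) ≥ 1/2`.
  have hΛ : 1 / 2 ≤ Real.log (1 + (V : ℝ) * ℓ * K) ^ (1 / 3 : ℝ) := by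
    have h1 : (1 : ℝ) ≤ V * ℓ * K :=
      one_le_mul_of_one_le_of_one_le (one_le_mul_of_one_le_of_one_le hV1 hℓ1) hK1
    have h2 : Real.log 2 ≤ Real.log (1 + (V : ℝ) * ℓ * K) :=
      Real.log_le_log (by norm_num) (by linarith)
    calc (1 / 2 : ℝ) = ((1 / 2 : ℝ) ^ 3) ^ (1 / 3 : ℝ) := by
          rw [← Real.rpow_natCast, ← Real.rpow_mul (by norm_num)]
          norm_num
      _ ≤ Real.log (1 + (V : ℝ) * ℓ * K) ^ (1 / 3 : ℝ) := by
          refine Real.rpow_le_rpow (by norm_num) ?_ (by norm_num)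
          linarith [Real.log_two_gt_d9]
  have hrate : 11 * (Q * ((T : ℝ) ^ (2 / 3 : ℝ) * H ^ (1 / 3 : ℝ) * (V : ℝ) ^ (1 / 3 : ℝ))) ≤
      22 * (1 + Real.log T) ^ 1 * TwoPartTariff.regretRate H ℓ K V T := by
    have h1 : 22 * (1 + Real.log T) ^ 1 * TwoPartTariff.regretRate H ℓ K V T =
        22 * (Q * ((T : ℝ) ^ (2 / 3 : ℝ) * H ^ (1 / 3 : ℝ) * (V : ℝ) ^ (1 / 3 : ℝ))) *
          Real.log (1 + (V : ℝ) * ℓ * K) ^ (1 / 3 : ℝ) := by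
      rw [TwoPartTariff.regretRate, Real.mul_rpow (by positivity) (by positivity),
        Real.mul_rpow (by positivity) (by positivity), hQ]
      ring
    have h2 : 0 ≤ Q * ((T : ℝ) ^ (2 / 3 : ℝ) * H ^ (1 / 3 : ℝ) * (V : ℝ) ^ (1 / 3 : ℝ)) := by
      positivity
    rw [h1]
    nlinarith
  have hsqrt : TwoPartTariff.expectedRegret A σ b T ≤ 11 * (Q * (H * √(T * V))) :=
    (hA b).trans_eq (by rw [hQ]; ring)
  have hT3 : (T : ℝ) = (T : ℝ) ^ (2 / 3 : ℝ) * (T : ℝ) ^ (1 / 3 : ℝ) := by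
    rw [← Real.rpow_add (by linarith)]
    norm_num
  -- With more buyer types than rounds, the trivial bound `H T` is within the rate.
  have hscaled : TwoPartTariff.expectedRegret A σ b T ≤
      H * (11 * (Q * ((T : ℝ) ^ (2 / 3 : ℝ) * (V : ℝ) ^ (1 / 3 : ℝ)))) := by
    rcases le_total (V : ℝ) T with hVT | hTV
    · refine hsqrt.trans ?_
      have h1 := TwoPartTariff.mul_sqrt_le_rpow (H := 1) one_pos (by linarith : (0 : ℝ) < T)
        (by linarith : (0 : ℝ) < V) (by simpa using hVT)
      rw [one_mul, Real.one_rpow, mul_one] at h1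
      calc 11 * (Q * (H * √(T * V))) = H * (11 * (Q * √(T * V))) := by ring
        _ ≤ _ := by gcongr
    · refine (TwoPartTariff.expectedRegret_le_mul hH hℓ hv hσ A b T).trans ?_
      have h1 : (T : ℝ) ≤ (T : ℝ) ^ (2 / 3 : ℝ) * (V : ℝ) ^ (1 / 3 : ℝ) := by
        conv_lhs => rw [hT3]
        gcongr
      have h2 : 0 ≤ (T : ℝ) ^ (2 / 3 : ℝ) * (V : ℝ) ^ (1 / 3 : ℝ) := by positivity
      refine mul_le_mul_of_nonneg_left ?_ hH.le
      nlinarith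
  have hsecond : TwoPartTariff.expectedRegret A σ b T ≤
      max 1 H ^ (2 / 3 : ℝ) *
        (22 * (1 + Real.log T) ^ 1 * TwoPartTariff.regretRate H ℓ K V T) := by
    refine hscaled.trans (le_trans ?_ (mul_le_mul_of_nonneg_left hrate (by positivity)))
    have hH3 : H ≤ max 1 H ^ (2 / 3 : ℝ) * H ^ (1 / 3 : ℝ) := by
      calc H = H ^ (2 / 3 : ℝ) * H ^ (1 / 3 : ℝ) := by
            rw [← Real.rpow_add hH]
            norm_num
        _ ≤ _ := by
            gcongr
            exact le_max_right _ _
    calc H * (11 * (Q * ((T : ℝ) ^ (2 / 3 : ℝ) * (V : ℝ) ^ (1 / 3 : ℝ))))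
        ≤ max 1 H ^ (2 / 3 : ℝ) * H ^ (1 / 3 : ℝ) *
          (11 * (Q * ((T : ℝ) ^ (2 / 3 : ℝ) * (V : ℝ) ^ (1 / 3 : ℝ)))) := by gcongr
      _ = _ := by ring
  refine ⟨fun hcase => ?_, hsecond⟩
  rcases le_or_gt H 1 with hH1 | hH1
  · rwa [max_eq_left hH1, Real.one_rpow, one_mul] at hsecond
  · have h4 : H ^ 4 * V ≤ T := hcase.resolve_left hH1.not_ge
    refine hsqrt.trans (le_trans ?_ hrate)
    have := TwoPartTariff.mul_sqrt_le_rpow hH (by linarith : (0 : ℝ) < T)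
      (by linarith : (0 : ℝ) < V) h4
    gcongr
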